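/- Let $d,n_1,\dots,n_d\ge 0$ and $r_0,\dots,r_d\ge 0$ be integers with $r_0=r_d=1$. For $\bar{\mathcal X}=(\mathcal X^1,\dots,\mathcal X^d)$ with core tensors $\mathcal X^k\in\mathbb R^{r_{k-1}\times n_k\times r_k}$, let $\mathcal X^k(i)\in\mathbb R^{r_{k-1}\times r_k}$ be the $i$-th slice and let $\phi(\bar{\mathcal X})\in\mathbb R^{n_1\times\cdots\times n_d}$ be the tensor with entries $\phi(\bar{\mathcal X})(i_1,\dots,i_d)=\mathcal X^1(i_1)\cdots\mathcal X^d(i_d)$. Let $L(\mathcal X^k)\in\mathbb R^{r_{k-1}n_k\times r_k}$, with $L(\mathcal X^k)(a+r_{k-1}(i-1),b)=\mathcal X^k(a,i,b)$, and $R(\mathcal X^k)\in\mathbb R^{r_{k-1}\times n_kr_k}$, with $R(\mathcal X^k)(a,i+n_k(b-1))=\mathcal X^k(a,i,b)$, be the left and right unfoldings. The total space $\overline{\mathcal M}_{\mathbf r}$ is the set of all $\bar{\mathcal X}$ with $\operatorname{rank}L(\mathcal X^k)=r_k$ and $\operatorname{rank}R(\mathcal X^k)=r_{k-1}$ for $k=1,\dots,d$.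 For $\bar\xi=(\xi^1,\dots,\xi^d)$ and $\bar\eta=(\eta^1,\dots,\eta^d)$ in $\prod_k\mathbb R^{r_{k-1}\times n_k\times r_k}$, the preconditioned metric is $$\bar g_{\bar{\mathcal X}}(\bar\xi,\bar\eta)=\sum_{k=1}^d\big\langle\phi(\mathcal X^1,\dots,\xi^k,\dots,\mathcal X^d),\ \phi(\mathcal X^1,\dots,\eta^k,\dots,\mathcal X^d)\big\rangle ,$$ where $\xi^k$ (resp. $\eta^k$) replaces $\mathcal X^k$ and $\langle\cdot,\cdot\rangle$ is the Euclidean inner product. The interface matrices are $\mathcal X^{\le k}\in\mathbb R^{n_1\cdots n_k\times r_k}$ with rows $\mathcal X^{\le k}(i_1,\dots,i_k;:)=\mathcal X^1(i_1)\cdots\mathcal X^k(i_k)$ and $\mathcal X^{\ge k}\in\mathbb R^{n_k\cdots n_d\times r_{k-1}}$ with rows $\mathcal X^{\ge k}(i_k,\dots,i_d;:)=[\mathcal X^k(i_k)\cdots\mathcal X^d(i_d)]^{\mathsf T}$, and $\mathcal X^{\le 0}=\mathcal X^{\ge d+1}=1$ (first mode indices fastest in the ordering of rows). The modified interface matrices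 $\mathcal X_\xi^{\le k,j}$ and $\mathcal X_\xi^{\ge k,j}$ are obtained from them by replacing $\mathcal X^j$ by $\xi^j$. Put $\mathbf L^k=(\mathcal X^{\le k})^{\mathsf T}\mathcal X^{\le k}$ and $\mathbf R^k=(\mathcal X^{\ge k})^{\mathsf T}\mathcal X^{\ge k}$, and let $\mathcal T^{<k>}$ be the unfolding of a tensor $\mathcal T$ with rows $(i_1,\dots,i_k)$ and columns $(i_{k+1},\dots,i_d)$. For $\bar\xi,\bar\lambda$ let $\bar\zeta=\bar\zeta_{\bar{\mathcal X}}(\bar\xi,\bar\lambda)=(\zeta^1,\dots,\zeta^d)$ be given by $$\begin{aligned} L(\zeta^k)={}&\big(I_{n_k}\otimes(\mathbf L^{k-1})^{-1}(\mathcal X^{\le k-1})^{\mathsf T}\big)\Big(\sum_{j\ne k}\phi(\mathcal X^1,\dots,\xi^j,\dots,\lambda^k,\dots,\mathcal X^d)\Big)^{<k>}\mathcal X^{\ge k+1}(\mathbf R^{k+1})^{-1}\\ &+\big(I_{n_k}\otimes(\mathbf L^{k-1})^{-1}(\mathcal X^{\le k-1})^{\mathsf T}\big)\Big(\sum_{j\ne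 k}\phi(\mathcal X^1,\dots,\lambda^j,\dots,\xi^k,\dots,\mathcal X^d)\Big)^{<k>}\mathcal X^{\ge k+1}(\mathbf R^{k+1})^{-1}\\ &+\sum_{j<k}\big(I_{n_k}\otimes(\mathbf L^{k-1})^{-1}(\mathcal X_\xi^{\le k-1,j})^{\mathsf T}\mathcal X^{\le k-1}\big)L(\lambda^k)+\sum_{j>k}L(\lambda^k)(\mathcal X^{\ge k+1})^{\mathsf T}\mathcal X_\xi^{\ge k+1,j}(\mathbf R^{k+1})^{-1}\\ &+\sum_{j<k}\big(I_{n_k}\otimes(\mathbf L^{k-1})^{-1}(\mathcal X_\lambda^{\le k-1,j})^{\mathsf T}\mathcal X^{\le k-1}\big)L(\xi^k)+\sum_{j>k}L(\xi^k)(\mathcal X^{\ge k+1})^{\mathsf T}\mathcal X_\lambda^{\ge k+1,j}(\mathbf R^{k+1})^{-1}\\ &-\sum_{j<k}\big(I_{n_k}\otimes(\mathbf L^{k-1})^{-1}(\mathcal X_\lambda^{\le k-1,j})^{\mathsf T}\mathcal X_\xi^{\le k-1,j}\big)L(\mathcal X^k)-\sum_{j>k}L(\mathcal X^k)(\mathcal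 X_\lambda^{\ge k+1,j})^{\mathsf T}\mathcal X_\xi^{\ge k+1,j}(\mathbf R^{k+1})^{-1}\\ &-\sum_{j<k}\big(I_{n_k}\otimes(\mathbf L^{k-1})^{-1}(\mathcal X_\xi^{\le k-1,j})^{\mathsf T}\mathcal X_\lambda^{\le k-1,j}\big)L(\mathcal X^k)-\sum_{j>k}L(\mathcal X^k)(\mathcal X_\xi^{\ge k+1,j})^{\mathsf T}\mathcal X_\lambda^{\ge k+1,j}(\mathbf R^{k+1})^{-1}. \end{aligned}$$ Then $\overline{\mathcal M}_{\mathbf r}$ is open in $\prod_k\mathbb R^{r_{k-1}\times n_k\times r_k}$, $\bar g$ is a smooth Riemannian metric on it, and its Levi-Civita connection $\nabla$ (the smooth, torsion-free covariant derivative compatible with $\bar g$) exists and satisfies, for every $\bar{\mathcal X}\in\overline{\mathcal M}_{\mathbf r}$, every tangent vector $\bar\xi$ at $\bar{\mathcal X}$ and every vector field $\bar\lambda$ that is differentiable at $\bar{\mathcal X}$, $$\nabla_{\bar\xi}\bar\lambda=\mathrm D\bar\lambda(\bar{\mathcal X})[\bar\xi]+\tfrac12\,\bar\zeta_{\bar{\mathcal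 X}}(\bar\xi,\bar\lambda_{\bar{\mathcal X}}).$$ -/

import Mathlib

open scoped Kronecker Manifold ContDiff Matrix

noncomputable section

/-! ### Riemannian metrics and the Levi-Civita connection on an open subset of a vector space

Every tangent space of an open set `U` of `E` is `E`; a vector field on `U` is a map `E → E` of
which only the values on `U` matter. -/

namespace FlatRiemannian

variable {E : Type*} [NormedAddCommGroup E] [NormedSpace ℝ E]

/-- `g x v w` is a smooth Riemannian metric on `U` (for finite-dimensional `E`, smoothness of the
tensor is smoothness of `x ↦ g x v w` for all fixed `v`, `w`). -/
structure IsRiemannianMetricOn (U : Set E) (g : E → E → E → ℝ) : Prop where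
  add_left : ∀ x ∈ U, ∀ v v' w : E, g x (v + v') w = g x v w + g x v' w
  smul_left : ∀ x ∈ U, ∀ (c : ℝ) (v w : E), g x (c • v) w = c * g x v w
  symm : ∀ x ∈ U, ∀ v w : E, g x v w = g x w v
  pos : ∀ x ∈ U, ∀ v : E, v ≠ 0 → 0 < g x v v
  smooth : ∀ v w : E, ContDiffOn ℝ ∞ (fun x => g x v w) U

/-- `cov` is the Levi-Civita (Riemannian) connection of the metric `g` on `U`: a smooth covariant
derivative on the tangent bundle that is torsion-free and compatible with `g`. As in Mathlib,
`cov Y x v` is `∇_v Y` at the point `x`. -/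
structure IsLeviCivitaOn (U : Set E) (g : E → E → E → ℝ)
    (cov : (E → E) → E → (E →L[ℝ] E)) : Prop where
  isCovariantDerivativeOn :
    IsCovariantDerivativeOn (I := 𝓘(ℝ, E)) (V := (TangentSpace 𝓘(ℝ, E) : E → Type _)) E cov U
  smooth : ∀ Y : E → E, ContDiffOn ℝ ∞ Y U → ContDiffOn ℝ ∞ (cov Y) U
  torsion_free : ∀ (X Y : E → E), ∀ x ∈ U, DifferentiableAt ℝ X x → DifferentiableAt ℝ Y x →
    cov Y x (X x) - cov X x (Y x) = VectorField.lieBracket ℝ X Y x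
  metric_compatible : ∀ (Y Z : E → E), ∀ x ∈ U, DifferentiableAt ℝ Y x → DifferentiableAt ℝ Z x →
    ∀ v : E, fderiv ℝ (fun y => g y (Y y) (Z y)) x v
      = g x (cov Y x v) (Z x) + g x (Y x) (cov Z x v)

end FlatRiemannian

/-! ### Tensor train format

Cores are numbered by `k : Fin d`; core `k` has size `r k.castSucc × n k × r k.succ`. The ranks
`r_0, …, r_d` are numbered by `m : Fin (d + 1)`. -/

namespace TensorTrain

variable {d : ℕ}

/-- Third-order tensors of the size of the `k`-th core. -/
abbrev Core (n : Fin d → ℕ) (r : Fin (d + 1) → ℕ) (k : Fin d) : Type :=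
  Fin (r k.castSucc) → Fin (n k) → Fin (r k.succ) → ℝ

/-- Families of `d` core tensors, without rank constraints. -/
abbrev Cores (n : Fin d → ℕ) (r : Fin (d + 1) → ℕ) : Type :=
  (k : Fin d) → Core n r k

/-- Multi-indices `(i_1, …, i_d)`. -/
abbrev MultiIndex (n : Fin d → ℕ) : Type := (j : Fin d) → Fin (n j)

/-- Multi-indices of the first `m` modes. -/
abbrev LeftIndex (n : Fin d → ℕ) (m : Fin (d + 1)) : Type :=
  (j : {j : Fin d // j.castSucc < m}) → Fin (n j)

/-- Multi-indices of the last `d - m` modes. -/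
abbrev RightIndex (n : Fin d → ℕ) (m : Fin (d + 1)) : Type :=
  (j : {j : Fin d // m ≤ j.castSucc}) → Fin (n j)

variable {n : Fin d → ℕ} {r : Fin (d + 1) → ℕ}

/-- The `i`-th slice of a core tensor, an `r_{k-1} × r_k` matrix. -/
def slice {k : Fin d} (Z : Core n r k) (i : Fin (n k)) :
    Matrix (Fin (r k.castSucc)) (Fin (r k.succ)) ℝ :=
  Matrix.of fun a b => Z a i b

/-- The left unfolding of a core, of size `r_{k-1} n_k × r_k`; the mode index `i` is the slow row
index, as in a Kronecker product with the identity of size `n_k` on the left. -/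
def leftUnfolding {k : Fin d} (Z : Core n r k) :
    Matrix (Fin (n k) × Fin (r k.castSucc)) (Fin (r k.succ)) ℝ :=
  Matrix.of fun p b => Z p.2 p.1 b

/-- The inverse of the left unfolding. -/
def leftFolding {k : Fin d} (A : Matrix (Fin (n k) × Fin (r k.castSucc)) (Fin (r k.succ)) ℝ) :
    Core n r k :=
  fun a i b => A (i, a) b

/-- The right unfolding of a core, of size `r_{k-1} × n_k r_k`. -/
def rightUnfolding {k : Fin d} (Z : Core n r k) :
    Matrix (Fin (r k.castSucc)) (Fin (r k.succ) × Fin (n k)) ℝ :=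
  Matrix.of fun a p => Z a p.2 p.1

/-- The total space: all left and right unfoldings of the cores have full rank. -/
def totalSpace (n : Fin d → ℕ) (r : Fin (d + 1) → ℕ) : Set (Cores n r) :=
  {X | ∀ k, (leftUnfolding (X k)).rank = r k.succ ∧ (rightUnfolding (X k)).rank = r k.castSucc}

/-- The left interface matrix with `m` factors: its row `(i_1, …, i_m)` is the row vector
`X¹(i_1) ⋯ Xᵐ(i_m)`. For `m = 0` it is `1` (recall `r_0 = 1`). -/
def leftInterface (X : Cores n r) (m : Fin (d + 1)) : Matrix (LeftIndex n m) (Fin (r m)) ℝ :=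
  Fin.induction (motive := fun m => Matrix (LeftIndex n m) (Fin (r m)) ℝ)
    (Matrix.of fun _ _ => 1)
    (fun k P => Matrix.of fun i => P (fun j => i ⟨j.1, j.2.trans k.castSucc_lt_succ⟩) ᵥ*
      slice (X k) (i ⟨k, k.castSucc_lt_succ⟩))
    m

/-- The right interface matrix with `d - m` factors: its row `(i_{m+1}, …, i_d)` is the transpose
of the column vector `X^{m+1}(i_{m+1}) ⋯ X^d(i_d)`. For `m = d` it is `1` (recall `r_d = 1`). -/
def rightInterface (X : Cores n r) (m : Fin (d + 1)) : Matrix (RightIndex n m) (Fin (r m)) ℝ :=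
  Fin.reverseInduction (motive := fun m => Matrix (RightIndex n m) (Fin (r m)) ℝ)
    (Matrix.of fun _ _ => 1)
    (fun k P => Matrix.of fun i => slice (X k) (i ⟨k, le_rfl⟩) *ᵥ
      P (fun j => i ⟨j.1, k.castSucc_lt_succ.le.trans j.2⟩))
    m

/-- The tensor represented by the cores: `φ(X)(i_1, …, i_d) = X¹(i_1) ⋯ X^d(i_d)`. The product is
a row vector of length `r_d = 1`, and the sum picks its only entry. -/
def phi (X : Cores n r) (i : MultiIndex n) : ℝ :=
  ∑ b, leftInterface X (Fin.last d) (fun j => i j.1) b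

/-- The preconditioned metric: the sum over `k` of the Euclidean inner products of
`φ(X¹, …, ξᵏ, …, X^d)` and `φ(X¹, …, ηᵏ, …, X^d)`. -/
def premetric (X ξ η : Cores n r) : ℝ :=
  ∑ k, ∑ i, phi (Function.update X k (ξ k)) i * phi (Function.update X k (η k)) i

/-- Put together `(i_1, …, i_{k-1})`, `i_k` and `(i_{k+1}, …, i_d)`. -/
def glue (k : Fin d) (i : LeftIndex n k.castSucc) (a : Fin (n k)) (i' : RightIndex n k.succ) :
    MultiIndex n := fun j =>
  if h : j.castSucc < k.castSucc then i ⟨j, h⟩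
  else if h' : k.succ ≤ j.castSucc then i' ⟨j, h'⟩
  else Fin.cast (congrArg n (by
    simp only [Fin.lt_def, Fin.le_def, Fin.val_castSucc, Fin.val_succ] at h h'
    exact Fin.ext (by omega))) a

/-- The unfolding of a tensor with rows `(i_1, …, i_k)` and columns `(i_{k+1}, …, i_d)`; the row
index is written as the pair of `i_k` and `(i_1, …, i_{k-1})`. -/
def unfolding (k : Fin d) (T : MultiIndex n → ℝ) :
    Matrix (Fin (n k) × LeftIndex n k.castSucc) (RightIndex n k.succ) ℝ :=
  Matrix.of fun p q => T (glue k p.2 p.1 q)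

/-- The product `X^{≤ m}ᵀ X^{≤ m}` of interface matrices. -/
def leftGram (X : Cores n r) (m : Fin (d + 1)) : Matrix (Fin (r m)) (Fin (r m)) ℝ :=
  (leftInterface X m)ᵀ * leftInterface X m

/-- The product `X^{≥ m+1}ᵀ X^{≥ m+1}` of interface matrices. -/
def rightGram (X : Cores n r) (m : Fin (d + 1)) : Matrix (Fin (r m)) (Fin (r m)) ℝ :=
  (rightInterface X m)ᵀ * rightInterface X m

/-- The modified left interface matrix: the `j`-th core of `X` is replaced by `ξʲ`. -/
def modLeft (X ξ : Cores n r) (m : Fin (d + 1)) (j : Fin d) :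
    Matrix (LeftIndex n m) (Fin (r m)) ℝ :=
  leftInterface (Function.update X j (ξ j)) m

/-- The modified right interface matrix: the `j`-th core of `X` is replaced by `ξʲ`. -/
def modRight (X ξ : Cores n r) (m : Fin (d + 1)) (j : Fin d) :
    Matrix (RightIndex n m) (Fin (r m)) ℝ :=
  rightInterface (Function.update X j (ξ j)) m

/-- The sum over `j ≠ k` of the tensors `φ(X¹, …, ξʲ, …, λᵏ, …, X^d)`. -/
def mixedSum (X ξ lam : Cores n r) (k : Fin d) : MultiIndex n → ℝ :=
  ∑ j ∈ Finset.univ.filter (fun j => j ≠ k),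
    phi (Function.update (Function.update X j (ξ j)) k (lam k))

/-- `(I ⊗ (L^{k-1})⁻¹ X^{≤ k-1}ᵀ) T^{<k>} X^{≥ k+1} (R^{k+1})⁻¹` for a tensor `T`. -/
def compress (X : Cores n r) (k : Fin d) (T : MultiIndex n → ℝ) :
    Matrix (Fin (n k) × Fin (r k.castSucc)) (Fin (r k.succ)) ℝ :=
  let M : Matrix (Fin (r k.castSucc)) (LeftIndex n k.castSucc) ℝ :=
    (leftGram X k.castSucc)⁻¹ * (leftInterface X k.castSucc)ᵀ
  let N : Matrix (RightIndex n k.succ) (Fin (r k.succ)) ℝ :=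
    rightInterface X k.succ * (rightGram X k.succ)⁻¹
  ((1 : Matrix (Fin (n k)) (Fin (n k)) ℝ) ⊗ₖ M) * unfolding k T * N

/-- `(I ⊗ (L^{k-1})⁻¹ Pᵀ Q) C` for matrices `P`, `Q` of the size of `X^{≤ k-1}` and a left
unfolded core `C`. -/
def leftCorrection (X : Cores n r) (k : Fin d)
    (P Q : Matrix (LeftIndex n k.castSucc) (Fin (r k.castSucc)) ℝ)
    (C : Matrix (Fin (n k) × Fin (r k.castSucc)) (Fin (r k.succ)) ℝ) :
    Matrix (Fin (n k) × Fin (r k.castSucc)) (Fin (r k.succ)) ℝ :=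
  ((1 : Matrix (Fin (n k)) (Fin (n k)) ℝ) ⊗ₖ ((leftGram X k.castSucc)⁻¹ * Pᵀ * Q)) * C

/-- `C Pᵀ Q (R^{k+1})⁻¹` for matrices `P`, `Q` of the size of `X^{≥ k+1}` and a left unfolded
core `C`. -/
def rightCorrection (X : Cores n r) (k : Fin d)
    (C : Matrix (Fin (n k) × Fin (r k.castSucc)) (Fin (r k.succ)) ℝ)
    (P Q : Matrix (RightIndex n k.succ) (Fin (r k.succ)) ℝ) :
    Matrix (Fin (n k) × Fin (r k.castSucc)) (Fin (r k.succ)) ℝ :=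
  C * Pᵀ * Q * (rightGram X k.succ)⁻¹

/-- The left unfolding of the `k`-th component of the correction term `ζ` of the connection. -/
def zetaUnfolded (X ξ lam : Cores n r) (k : Fin d) :
    Matrix (Fin (n k) × Fin (r k.castSucc)) (Fin (r k.succ)) ℝ :=
  let A := leftInterface X k.castSucc
  let B := rightInterface X k.succ
  let Aξ := modLeft X ξ k.castSucc
  let Alam := modLeft X lam k.castSucc
  let Bξ := modRight X ξ k.succ
  let Blam := modRight X lam k.succ
  compress X k (mixedSum X ξ lam k)
  + compress X k (mixedSum X lam ξ k)
  + (∑ j ∈ Finset.Iio k, leftCorrection X k (Aξ j) A (leftUnfolding (lam k)))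
  + (∑ j ∈ Finset.Ioi k, rightCorrection X k (leftUnfolding (lam k)) B (Bξ j))
  + (∑ j ∈ Finset.Iio k, leftCorrection X k (Alam j) A (leftUnfolding (ξ k)))
  + (∑ j ∈ Finset.Ioi k, rightCorrection X k (leftUnfolding (ξ k)) B (Blam j))
  - (∑ j ∈ Finset.Iio k, leftCorrection X k (Alam j) (Aξ j) (leftUnfolding (X k)))
  - (∑ j ∈ Finset.Ioi k, rightCorrection X k (leftUnfolding (X k)) (Blam j) (Bξ j))
  - (∑ j ∈ Finset.Iio k, leftCorrection X k (Aξ j) (Alam j) (leftUnfolding (X k)))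
  - (∑ j ∈ Finset.Ioi k, rightCorrection X k (leftUnfolding (X k)) (Bξ j) (Blam j))

/-- The correction term `ζ` at `X`, for the tangent vectors `ξ` and `lam` at `X`. -/
def zeta (X ξ lam : Cores n r) : Cores n r :=
  fun k => leftFolding (zetaUnfolded X ξ lam k)

end TensorTrain

end

/-!
A Levi-Civita connection satisfies the Koszul formula. Writing `∇ = D + Γ`, it says that
`2 g(Γ(u, v), w)` is `koszul g x u v w`, the combination of the derivatives of `g` in the constant
directions `u`, `v`, `w`. Since `g` is positive definite, this determines `Γ`, and conversely the
bilinear `Γ` so defined is smooth and gives a Levi-Civita connection. It remains to see that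
`g(ζ(ξ, λ), η)` is the Koszul combination.

By multilinearity of `φ`, the derivative of the preconditioned metric is a sum of inner products of
tensors `φ` in which one or two cores are replaced. Full rank of the unfoldings propagates to the
interface matrices, so the Gram matrices are invertible and every linear form
`D ↦ ⟨T, φ(Z¹, …, D, …, Z^d)⟩` on `k`-th cores is `⟨φ(X¹, …, M, …, X^d), φ(X¹, …, D, …, X^d)⟩` for
an explicit core `M`, obtained by solving with the Gram matrices. Each of the ten terms of `ζᵏ` is
an `M` of this kind, or a sum of such over part of the indices `j ≠ k`. Summing over `k`, the
subtracted terms `⟨φ(…, ξʲ, …), φ(…, λʲ, …, ηᵏ, …)⟩` become Koszul terms after interchanging `j` and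
`k`.
-/

noncomputable section

namespace FlatRiemannian

section FlatConnection

variable {E : Type*} [NormedAddCommGroup E] [NormedSpace ℝ E]

theorem differentiableAt_of_mdifferentiableAt_section
    {Y : (x : E) → TangentSpace 𝓘(ℝ, E) x} {x : E}
    (h : MDifferentiableAt 𝓘(ℝ, E) (𝓘(ℝ, E).prod 𝓘(ℝ, E))
      (fun y => Bundle.TotalSpace.mk' E (E := (TangentSpace 𝓘(ℝ, E) : E → Type _)) y (Y y)) x) :
    DifferentiableAt ℝ (Y : E → E) x := by
  have h' := (mdifferentiableAt_section (F := E) (IB := 𝓘(ℝ, E)) Y).1 h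
  simp only [trivializationAt_model_space_apply] at h'
  exact mdifferentiableAt_iff_differentiableAt.1 h'

theorem isCovariantDerivativeOn_fderiv (U : Set E) :
    IsCovariantDerivativeOn (I := 𝓘(ℝ, E)) (V := (TangentSpace 𝓘(ℝ, E) : E → Type _)) E
      (fun (Y : E → E) x => fderiv ℝ Y x) U where
  add hY hY' _ :=
    fderiv_add (E := E) (F := E) (differentiableAt_of_mdifferentiableAt_section hY)
      (differentiableAt_of_mdifferentiableAt_section hY')
  leibniz {Y f x} hY hf _ := by
    have h := fderiv_smul (E := E) (F := E) (mdifferentiableAt_iff_differentiableAt.1 hf)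
      (differentiableAt_of_mdifferentiableAt_section hY)
    rwa [← mfderiv_eq_fderiv (f := f)] at h

end FlatConnection

set_option maxSynthPendingDepth 3 in
theorem fderiv_bilinear_apply {E F F' : Type*} [NormedAddCommGroup E] [NormedSpace ℝ E]
    [NormedAddCommGroup F] [NormedSpace ℝ F] [NormedAddCommGroup F'] [NormedSpace ℝ F']
    {G : E → F →L[ℝ] F' →L[ℝ] ℝ} {Y : E → F} {Z : E → F'} {x : E} (hG : DifferentiableAt ℝ G x)
    (hY : DifferentiableAt ℝ Y x) (hZ : DifferentiableAt ℝ Z x) (v : E) :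
    fderiv ℝ (fun y => G y (Y y) (Z y)) x v =
      fderiv ℝ G x v (Y x) (Z x) + G x (fderiv ℝ Y x v) (Z x) + G x (Y x) (fderiv ℝ Z x v) := by
  rw [((hG.hasFDerivAt.clm_apply hY.hasFDerivAt).clm_apply hZ.hasFDerivAt).fderiv]
  simp only [add_apply, ContinuousLinearMap.flip_apply, ContinuousLinearMap.comp_apply]
  ring

namespace IsRiemannianMetricOn

variable {E : Type*} [NormedAddCommGroup E] [NormedSpace ℝ E] {U : Set E} {g : E → E → E → ℝ}
  {x : E}

theorem add_right (hg : IsRiemannianMetricOn U g) (hx : x ∈ U) (v w w' : E) :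
    g x v (w + w') = g x v w + g x v w' := by
  rw [hg.symm x hx, hg.add_left x hx, hg.symm x hx w, hg.symm x hx w']

theorem smul_right (hg : IsRiemannianMetricOn U g) (hx : x ∈ U) (c : ℝ) (v w : E) :
    g x v (c • w) = c * g x v w := by
  rw [hg.symm x hx, hg.smul_left x hx, hg.symm x hx w]

theorem sub_left (hg : IsRiemannianMetricOn U g) (hx : x ∈ U) (v v' w : E) :
    g x (v - v') w = g x v w - g x v' w := by
  rw [eq_sub_iff_add_eq, ← hg.add_left x hx, sub_add_cancel]

theorem neg_left (hg : IsRiemannianMetricOn U g) (hx : x ∈ U) (v w : E) :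
    g x (-v) w = -g x v w := by
  rw [← neg_one_smul ℝ v, hg.smul_left x hx, neg_one_mul]

theorem zero_left (hg : IsRiemannianMetricOn U g) (hx : x ∈ U) (w : E) : g x 0 w = 0 := by
  rw [← zero_smul ℝ (0 : E), hg.smul_left x hx, zero_mul]

theorem zero_right (hg : IsRiemannianMetricOn U g) (hx : x ∈ U) (v : E) : g x v 0 = 0 := by
  rw [hg.symm x hx, hg.zero_left hx]

theorem eq_of_forall_left (hg : IsRiemannianMetricOn U g) (hx : x ∈ U) {v v' : E}
    (h : ∀ w, g x v w = g x v' w) : v = v' := by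
  by_contra hne
  have := hg.pos x hx (v - v') (sub_ne_zero.2 hne)
  rw [hg.sub_left hx, h, sub_self] at this
  exact lt_irrefl _ this

theorem exists_contDiffOn_bilinear [FiniteDimensional ℝ E] (hg : IsRiemannianMetricOn U g) :
    ∃ G : E → E →L[ℝ] E →L[ℝ] ℝ, (∀ x ∈ U, ∀ v w, G x v w = g x v w) ∧ ContDiffOn ℝ ∞ G U := by
  have bundle : ∀ x, ∃ T : E →L[ℝ] E →L[ℝ] ℝ, x ∈ U → ∀ v w, T v w = g x v w := by
    intro x
    by_cases hx : x ∈ U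
    · exact ⟨LinearMap.toContinuousBilinearMap <| LinearMap.mk₂ ℝ (g x) (hg.add_left x hx)
        (hg.smul_left x hx) (hg.add_right hx) (hg.smul_right hx), fun _ _ _ => rfl⟩
    · exact ⟨0, fun h => absurd h hx⟩
  choose G hG using bundle
  exact ⟨G, hG, contDiffOn_clm_apply.2 fun v => contDiffOn_clm_apply.2 fun w =>
    (hg.smooth v w).congr fun x hx => hG x hx v w⟩

theorem fderiv_symm (hg : IsRiemannianMetricOn U g) (hU : IsOpen U) (hx : x ∈ U) (v w : E) :
    fderiv ℝ (fun y => g y v w) x = fderiv ℝ (fun y => g y w v) x :=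
  Filter.EventuallyEq.fderiv_eq <| by
    filter_upwards [hU.mem_nhds hx] with y hy using hg.symm y hy v w

theorem fderiv_apply_fields [FiniteDimensional ℝ E] (hg : IsRiemannianMetricOn U g)
    (hU : IsOpen U) (hx : x ∈ U) {Y Z : E → E} (hY : DifferentiableAt ℝ Y x)
    (hZ : DifferentiableAt ℝ Z x) (v : E) :
    fderiv ℝ (fun y => g y (Y y) (Z y)) x v = fderiv ℝ (fun y => g y (Y x) (Z x)) x v
      + g x (fderiv ℝ Y x v) (Z x) + g x (Y x) (fderiv ℝ Z x v) := by
  obtain ⟨G, hG, hGs⟩ := hg.exists_contDiffOn_bilinear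
  have hGx : DifferentiableAt ℝ G x :=
    (hGs.contDiffAt (hU.mem_nhds hx)).differentiableAt (by simp)
  have fderiv_bundled (Y Z : E → E) :
      fderiv ℝ (fun y => g y (Y y) (Z y)) x = fderiv ℝ (fun y => G y (Y y) (Z y)) x :=
    Filter.EventuallyEq.fderiv_eq <| by
      filter_upwards [hU.mem_nhds hx] with y hy using (hG y hy _ _).symm
  rw [fderiv_bundled Y Z, fderiv_bundled (fun _ => Y x) fun _ => Z x,
    fderiv_bilinear_apply hGx hY hZ,
    fderiv_bilinear_apply hGx (differentiableAt_const _) (differentiableAt_const _),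
    ← hG x hx, ← hG x hx]
  simp only [fderiv_fun_const, Pi.zero_apply, zero_apply, map_zero, add_zero]

end IsRiemannianMetricOn

section Koszul

set_option maxSynthPendingDepth 3

variable {E : Type*} [NormedAddCommGroup E] [NormedSpace ℝ E] {U : Set E} {g : E → E → E → ℝ}
  {x : E}

/-- The right-hand side of the Koszul formula for constant vector fields `u`, `v`, `w`, that is,
twice the Christoffel symbol of the first kind of `g` at `x`. -/
def koszul (g : E → E → E → ℝ) (x u v w : E) : ℝ :=
  fderiv ℝ (fun y => g y v w) x u + fderiv ℝ (fun y => g y u w) x v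
    - fderiv ℝ (fun y => g y u v) x w

theorem IsRiemannianMetricOn.koszul_symm (hg : IsRiemannianMetricOn U g) (hU : IsOpen U)
    (hx : x ∈ U) (u v w : E) : koszul g x u v w = koszul g x v u w := by
  rw [koszul, koszul, hg.fderiv_symm hU hx u v]
  ring

theorem IsLeviCivitaOn.koszul_formula {cov : (E → E) → E → (E →L[ℝ] E)}
    (hcov : IsLeviCivitaOn U g cov) (hg : IsRiemannianMetricOn U g) (hx : x ∈ U) {X Y Z : E → E}
    (hX : DifferentiableAt ℝ X x) (hY : DifferentiableAt ℝ Y x) (hZ : DifferentiableAt ℝ Z x) :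
    2 * g x (cov Y x (X x)) (Z x) =
      fderiv ℝ (fun y => g y (Y y) (Z y)) x (X x) + fderiv ℝ (fun y => g y (X y) (Z y)) x (Y x)
        - fderiv ℝ (fun y => g y (X y) (Y y)) x (Z x)
        + g x (VectorField.lieBracket ℝ X Y x) (Z x) - g x (VectorField.lieBracket ℝ X Z x) (Y x)
        - g x (VectorField.lieBracket ℝ Y Z x) (X x) := by
  rw [hcov.metric_compatible Y Z x hx hY hZ, hcov.metric_compatible X Z x hx hX hZ,
    hcov.metric_compatible X Y x hx hX hY, ← hcov.torsion_free X Y x hx hX hY,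
    ← hcov.torsion_free X Z x hx hX hZ, ← hcov.torsion_free Y Z x hx hY hZ,
    hg.sub_left hx, hg.sub_left hx, hg.sub_left hx, hg.symm x hx (Y x), hg.symm x hx (X x),
    hg.symm x hx (X x)]
  ring

theorem IsLeviCivitaOn.eq_fderiv_add [FiniteDimensional ℝ E] {cov : (E → E) → E → (E →L[ℝ] E)}
    (hcov : IsLeviCivitaOn U g cov) (hg : IsRiemannianMetricOn U g) (hU : IsOpen U) (hx : x ∈ U)
    {Y : E → E} (hY : DifferentiableAt ℝ Y x) {v γ : E}
    (hγ : ∀ w, 2 * g x γ w = koszul g x v (Y x) w) :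
    cov Y x v = fderiv ℝ Y x v + γ := by
  refine hg.eq_of_forall_left hx fun w => ?_
  have hv : DifferentiableAt ℝ (fun _ : E => v) x := differentiableAt_const v
  have hw : DifferentiableAt ℝ (fun _ : E => w) x := differentiableAt_const w
  have formula := hcov.koszul_formula hg hx hv hY hw
  simp only [VectorField.lieBracket, hg.fderiv_apply_fields hU hx hY hw,
    hg.fderiv_apply_fields hU hx hv hY, fderiv_fun_const, Pi.zero_apply, zero_apply, sub_zero,
    zero_sub, hg.zero_left hx, hg.zero_right hx, hg.neg_left hx,
    hg.symm x hx v (fderiv ℝ Y x w)] at formula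
  have hγw := hγ w
  rw [koszul] at hγw
  rw [hg.add_left x hx]
  linarith

theorem isInvertible_of_forall_apply_self_pos [FiniteDimensional ℝ E] {T : E →L[ℝ] E →L[ℝ] ℝ}
    (hT : ∀ v, v ≠ 0 → 0 < T v v) : T.IsInvertible := by
  have hinj : Function.Injective (T : E →ₗ[ℝ] E →L[ℝ] ℝ) := by
    refine (injective_iff_map_eq_zero _).2 fun v hv => by_contra fun hne => ?_
    have hpos := hT v hne
    rw [show T v = 0 from hv, zero_apply] at hpos
    exact lt_irrefl 0 hpos
  have hdim : Module.finrank ℝ E = Module.finrank ℝ (E →L[ℝ] ℝ) := by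
    rw [← Subspace.dual_finrank_eq, LinearMap.toContinuousLinearMap.finrank_eq]
  exact ⟨(LinearMap.linearEquivOfInjective _ hinj hdim).toContinuousLinearEquiv, rfl⟩

/-- The Koszul form of a field `G` of bilinear forms with derivative `D` at a point, as a continuous
trilinear form: `(u, v, w) ↦ D u v w + D v u w - D w u v`. -/
def koszulForm (D : E →L[ℝ] E →L[ℝ] E →L[ℝ] ℝ) : E →L[ℝ] E →L[ℝ] E →L[ℝ] ℝ :=
  D + D.flip
    - ((ContinuousLinearMap.flipₗᵢ ℝ E E ℝ).toContinuousLinearEquiv : _ →L[ℝ] _).comp D.flip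

theorem contDiff_koszulForm : ContDiff ℝ ∞ (koszulForm : (E →L[ℝ] E →L[ℝ] E →L[ℝ] ℝ) → _) := by
  have hflip : ContDiff ℝ ∞ fun D : E →L[ℝ] E →L[ℝ] E →L[ℝ] ℝ => D.flip :=
    (ContinuousLinearMap.flipₗᵢ ℝ E E (E →L[ℝ] ℝ)).contDiff
  exact (contDiff_id.add hflip).sub (contDiff_const.clm_comp hflip)

theorem IsRiemannianMetricOn.exists_christoffel [FiniteDimensional ℝ E]
    (hg : IsRiemannianMetricOn U g) (hU : IsOpen U) :
    ∃ Γ : E → E →L[ℝ] E →L[ℝ] E, ContDiffOn ℝ ∞ Γ U ∧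
      ∀ x ∈ U, ∀ u v w, 2 * g x (Γ x u v) w = koszul g x u v w := by
  obtain ⟨G, hG, hGs⟩ := hg.exists_contDiffOn_bilinear
  have hinv : ∀ x ∈ U, (G x).IsInvertible := fun x hx =>
    isInvertible_of_forall_apply_self_pos fun v hv => by simpa only [hG x hx] using hg.pos x hx v hv
  have hderiv (x) (hx : x ∈ U) (u v w) :
      fderiv ℝ G x u v w = fderiv ℝ (fun y => g y v w) x u := by
    have heq : (fun y => g y v w) =ᶠ[nhds x] fun y => G y v w := by
      filter_upwards [hU.mem_nhds hx] with y hy using (hG y hy _ _).symm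
    rw [heq.fderiv_eq, fderiv_bilinear_apply
      ((hGs.contDiffAt (hU.mem_nhds hx)).differentiableAt (by simp))
      (differentiableAt_const v) (differentiableAt_const w)]
    simp only [fderiv_fun_const, Pi.zero_apply, zero_apply, map_zero, add_zero]
  refine ⟨fun x => (ContinuousLinearMap.compL ℝ E (E →L[ℝ] ℝ) E (G x).inverse).comp
    ((1 / 2 : ℝ) • koszulForm (fderiv ℝ G x)), ?_, fun x hx u v w => ?_⟩
  · have hinverse : ContDiffOn ℝ ∞ (fun x => (G x).inverse) U := fun x hx =>
      ((hinv x hx).contDiffAt_map_inverse).comp_contDiffWithinAt x (hGs x hx)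
    have hkoszul : ContDiffOn ℝ ∞ (fun x => koszulForm (fderiv ℝ G x)) U :=
      contDiff_koszulForm.comp_contDiffOn (hGs.fderiv_of_isOpen hU (by simp))
    exact ((ContinuousLinearMap.contDiff _).comp_contDiffOn hinverse).clm_comp
      (hkoszul.const_smul _)
  · rw [← hG x hx]
    simp [(hinv x hx).self_apply_inverse, koszulForm, koszul, hderiv x hx]

theorem IsRiemannianMetricOn.isLeviCivitaOn_fderiv_add [FiniteDimensional ℝ E]
    (hg : IsRiemannianMetricOn U g) (hU : IsOpen U) {Γ : E → E →L[ℝ] E →L[ℝ] E}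
    (hΓs : ContDiffOn ℝ ∞ Γ U)
    (hΓ : ∀ x ∈ U, ∀ u v w, 2 * g x (Γ x u v) w = koszul g x u v w) :
    IsLeviCivitaOn U g fun Y x => fderiv ℝ Y x + Γ x (Y x) where
  isCovariantDerivativeOn := (isCovariantDerivativeOn_fderiv U).add_one_form Γ
  smooth Y hY := (hY.fderiv_of_isOpen hU (by simp)).add (hΓs.clm_apply hY)
  torsion_free X Y x hx _ _ := by
    have hsymm : Γ x (X x) (Y x) = Γ x (Y x) (X x) := hg.eq_of_forall_left hx fun w => by
      linarith [hΓ x hx (X x) (Y x) w, hΓ x hx (Y x) (X x) w, hg.koszul_symm hU hx (X x) (Y x) w]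
    simp only [add_apply, VectorField.lieBracket, hsymm]
    abel
  metric_compatible Y Z x hx hY hZ v := by
    have hY' := hΓ x hx (Y x) v (Z x)
    have hZ' := hΓ x hx (Z x) v (Y x)
    rw [koszul, hg.fderiv_symm hU hx v (Z x)] at hY'
    rw [koszul, hg.fderiv_symm hU hx (Z x) (Y x), hg.fderiv_symm hU hx v (Y x)] at hZ'
    simp only [add_apply]
    rw [hg.fderiv_apply_fields hU hx hY hZ, hg.add_left x hx, hg.add_right hx,
      hg.symm x hx (Y x) (Γ x _ _)]
    linarith

theorem IsRiemannianMetricOn.exists_isLeviCivitaOn [FiniteDimensional ℝ E]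
    (hg : IsRiemannianMetricOn U g) (hU : IsOpen U) : ∃ cov, IsLeviCivitaOn U g cov := by
  obtain ⟨Γ, hΓs, hΓ⟩ := hg.exists_christoffel hU
  exact ⟨_, hg.isLeviCivitaOn_fderiv_add hU hΓs hΓ⟩

end Koszul

end FlatRiemannian

namespace TensorTrain

section FullColumnRank

variable {K ι κ : Type*} [Field K] [Fintype κ]

theorem rank_eq_card_width_iff_linearIndependent {A : Matrix ι κ K} :
    A.rank = Fintype.card κ ↔ LinearIndependent K A.col := by
  rw [linearIndependent_iff_card_eq_finrank_span, Set.finrank, A.rank_eq_finrank_span_cols, eq_comm]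

theorem rank_eq_card_width_iff_forall_mulVec {A : Matrix ι κ K} :
    A.rank = Fintype.card κ ↔ ∀ v, A *ᵥ v = 0 → v = 0 := by
  rw [rank_eq_card_width_iff_linearIndependent, ← Matrix.mulVec_injective_iff]
  exact injective_iff_map_eq_zero A.mulVecLin

theorem isUnit_det_transpose_mul_self [LinearOrder K] [IsStrictOrderedRing K] [Fintype ι]
    [DecidableEq κ] {A : Matrix ι κ K} (hA : A.rank = Fintype.card κ) : IsUnit (Aᵀ * A).det := by
  have hgram : (Aᵀ * A).rank = Fintype.card κ := (Matrix.rank_transpose_mul_self A).trans hA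
  rw [← Matrix.isUnit_iff_isUnit_det, ← Matrix.linearIndependent_cols_iff_isUnit]
  exact rank_eq_card_width_iff_linearIndependent.1 hgram

theorem isOpen_setOf_rank_eq_card_width {𝕜 : Type*} [NontriviallyNormedField 𝕜] [CompleteSpace 𝕜]
    [Finite ι] : IsOpen {A : Matrix ι κ 𝕜 | A.rank = Fintype.card κ} := by
  cases nonempty_fintype ι
  have hcol : Continuous fun A : Matrix ι κ 𝕜 => A.col := continuous_id.matrix_transpose
  simp only [rank_eq_card_width_iff_linearIndependent]
  exact (isOpen_setOfPred_linearIndependent (𝕜 := 𝕜) (ι := κ) (E := ι → 𝕜)).preimage hcol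

theorem rank_of_one_eq_card_width [Nonempty ι] (hκ : Fintype.card κ = 1) :
    (Matrix.of fun (_ : ι) (_ : κ) => (1 : K)).rank = Fintype.card κ := by
  obtain ⟨c, hc⟩ := Fintype.card_eq_one_iff.1 hκ
  refine rank_eq_card_width_iff_forall_mulVec.2 fun v hv => funext fun b => ?_
  obtain ⟨i⟩ := ‹Nonempty ι›
  have : Unique κ := ⟨⟨c⟩, hc⟩
  simpa [Matrix.mulVec, dotProduct, Subsingleton.elim b default] using congrFun hv i

end FullColumnRank

section Contract

variable {R ι ι' κ κ' μ μ' ν ν' σ : Type*} [CommRing R] [Fintype σ] [DecidableEq σ] [Fintype κ]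
  [Fintype κ'] [Fintype ν] [Fintype ν']

/-- The product `(I ⊗ A) C Bᵀ`: a left unfolded core `C` is multiplied by `A` along its first mode
and by `B` along its last mode. All unfoldings and all correction terms have this form. -/
def contract (A : Matrix ι κ R) (C : Matrix (σ × κ) ν R) (B : Matrix μ ν R) :
    Matrix (σ × ι) μ R :=
  ((1 : Matrix σ σ R) ⊗ₖ A) * C * Bᵀ

theorem contract_apply (A : Matrix ι κ R) (C : Matrix (σ × κ) ν R) (B : Matrix μ ν R) (s : σ)
    (i : ι) (j : μ) :
    contract A C B (s, i) j = (A i ᵥ* Matrix.of fun a b => C (s, a) b) ⬝ᵥ B j := by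
  rw [contract, Matrix.mul_apply]
  refine Finset.sum_congr rfl fun b _ => congrArg (· * B j b) ?_
  simp [Matrix.mul_apply, Fintype.sum_prod_type, Matrix.one_apply, Matrix.vecMul, dotProduct]

theorem contract_contract [Fintype ι] [Fintype μ] (A' : Matrix ι' ι R) (A : Matrix ι κ R)
    (C : Matrix (σ × κ) ν R) (B' : Matrix μ' μ R) (B : Matrix μ ν R) :
    contract A' (contract A C B) B' = contract (A' * A) C (B' * B) := by
  have hA : (1 : Matrix σ σ R) ⊗ₖ (A' * A)
      = (((1 : Matrix σ σ R) ⊗ₖ A' : Matrix (σ × ι') (σ × ι) R)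
        * ((1 : Matrix σ σ R) ⊗ₖ A : Matrix (σ × ι) (σ × κ) R)) := by
    rw [← Matrix.mul_kronecker_mul, Matrix.one_mul]
  simp only [contract, hA, Matrix.transpose_mul, Matrix.mul_assoc]

theorem contract_one_one [DecidableEq κ] [DecidableEq ν] (C : Matrix (σ × κ) ν R) :
    contract 1 C 1 = C := by
  rw [contract, Matrix.one_kronecker_one, Matrix.transpose_one, Matrix.one_mul, Matrix.mul_one]

theorem contract_add (A : Matrix ι κ R) (C D : Matrix (σ × κ) ν R) (B : Matrix μ ν R) :
    contract A (C + D) B = contract A C B + contract A D B := by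
  simp only [contract, Matrix.mul_add, Matrix.add_mul]

theorem contract_smul (A : Matrix ι κ R) (c : R) (C : Matrix (σ × κ) ν R) (B : Matrix μ ν R) :
    contract A (c • C) B = c • contract A C B := by
  simp only [contract, Matrix.mul_smul, Matrix.smul_mul]

theorem trace_transpose_contract_mul [Fintype ι] [Fintype μ] (A : Matrix ι κ R)
    (C : Matrix (σ × κ) ν R) (B : Matrix μ ν R) (D : Matrix (σ × ι) μ R) :
    ((contract A C B)ᵀ * D).trace = (Cᵀ * contract Aᵀ D Bᵀ).trace := by
  have hA : ((1 : Matrix σ σ R) ⊗ₖ A)ᵀ = 1 ⊗ₖ Aᵀ := by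
    rw [← Matrix.kroneckerMap_transpose, Matrix.transpose_one]
  simp only [contract, Matrix.transpose_mul, Matrix.transpose_transpose, hA, Matrix.mul_assoc]
  rw [Matrix.trace_mul_comm]
  simp only [Matrix.mul_assoc]

theorem trace_transpose_contract_gram_inv [DecidableEq κ] [DecidableEq ν] [Fintype ι] [Fintype μ]
    [Fintype ι'] [Fintype μ'] {A : Matrix ι κ R} {B : Matrix μ ν R} (hA : IsUnit (Aᵀ * A).det)
    (hB : IsUnit (Bᵀ * B).det) (P : Matrix ι' κ R) (Q : Matrix μ' ν R)
    (W : Matrix (σ × ι') μ' R) (D : Matrix (σ × κ) ν R) :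
    ((contract A (contract ((Aᵀ * A)⁻¹ * Pᵀ) W ((Bᵀ * B)⁻¹ * Qᵀ)) B)ᵀ * contract A D B).trace
      = (Wᵀ * contract P D Q).trace := by
  rw [trace_transpose_contract_mul, trace_transpose_contract_mul, contract_contract,
    contract_contract]
  simp only [Matrix.transpose_mul, Matrix.transpose_transpose, Matrix.transpose_nonsing_inv,
    Matrix.mul_assoc, Matrix.nonsing_inv_mul _ hA, Matrix.nonsing_inv_mul _ hB, Matrix.mul_one]

end Contract

section Calculus

variable {𝕜 ι : Type*} [NontriviallyNormedField 𝕜]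

section Update

variable [DecidableEq ι] {E : ι → Type*} [∀ i, NormedAddCommGroup (E i)]
  [∀ i, NormedSpace 𝕜 (E i)]

theorem contDiff_update_left [Fintype ι] {N : WithTop ℕ∞} (k : ι) (z : E k) :
    ContDiff 𝕜 N fun x : ∀ i, E i => Function.update x k z := by
  refine contDiff_pi.2 fun j => ?_
  rcases eq_or_ne j k with rfl | hj
  · simpa using contDiff_const
  · simpa [Function.update_of_ne hj] using contDiff_pi.1 contDiff_id j

theorem hasFDerivAt_update_left [Finite ι] (k : ι) (z : E k) (x : ∀ i, E i) :
    HasFDerivAt (fun x : ∀ i, E i => Function.update x k z)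
      (.pi (Function.update (fun i => .proj i) k 0) : (∀ i, E i) →L[𝕜] ∀ i, E i) x := by
  cases nonempty_fintype ι
  rw [hasFDerivAt_pi]
  intro j
  rcases eq_or_ne j k with rfl | hj
  · simpa using hasFDerivAt_const z x
  · simpa [hj] using hasFDerivAt_apply j x

end Update

variable [Fintype ι] {E : Type*} [NormedAddCommGroup E] [NormedSpace 𝕜 E] {f g : E → ι → 𝕜}

theorem contDiff_dotProduct {N : WithTop ℕ∞} (hf : ContDiff 𝕜 N f) (hg : ContDiff 𝕜 N g) :
    ContDiff 𝕜 N fun x => f x ⬝ᵥ g x :=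
  ContDiff.sum fun i _ => (contDiff_pi.1 hf i).mul (contDiff_pi.1 hg i)

theorem fderiv_dotProduct {x : E} (hf : DifferentiableAt 𝕜 f x) (hg : DifferentiableAt 𝕜 g x)
    (v : E) :
    fderiv 𝕜 (fun y => f y ⬝ᵥ g y) x v = fderiv 𝕜 f x v ⬝ᵥ g x + f x ⬝ᵥ fderiv 𝕜 g x v := by
  have hf' := hasFDerivAt_pi'.1 hf.hasFDerivAt
  have hg' := hasFDerivAt_pi'.1 hg.hasFDerivAt
  have h := HasFDerivAt.fun_sum (u := Finset.univ) fun i _ => (hf' i).fun_mul (hg' i)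
  simp only [dotProduct]
  rw [h.fderiv]
  simp [Finset.sum_add_distrib, mul_comm, add_comm]

end Calculus

section Index

theorem exists_extension {ι : Type*} {β : ι → Type*} {p q : ι → Prop} {k : ι} (hk : ¬ p k)
    (hqk : q k) (hpq : ∀ j, p j → q j) (hqp : ∀ j, q j → j = k ∨ p j) (a : β k)
    (i : ∀ j : {j // p j}, β j) :
    ∃ i' : ∀ j : {j // q j}, β j, i' ⟨k, hqk⟩ = a ∧ ∀ j : {j // p j}, i' ⟨j, hpq j j.2⟩ = i j := by
  classical
  refine ⟨fun j => if h : j.1 = k then h ▸ a else i ⟨j, (hqp j j.2).resolve_left h⟩, by simp,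
    fun j => ?_⟩
  have hjk : j.1 ≠ k := fun hjk => hk (hjk ▸ j.2)
  simp [hjk]

theorem sum_Iio_add_sum_Ioi {ι M : Type*} [AddCommMonoid M] [LinearOrder ι] [Fintype ι]
    [LocallyFiniteOrderBot ι] [LocallyFiniteOrderTop ι] (k : ι) (f : ι → M) :
    ∑ j ∈ Finset.Iio k, f j + ∑ j ∈ Finset.Ioi k, f j = ∑ j with j ≠ k, f j := by
  have hdisj : Disjoint (Finset.Iio k) (Finset.Ioi k) := Finset.disjoint_left.2 fun j hlt hgt =>
    (Finset.mem_Iio.1 hlt).not_gt (Finset.mem_Ioi.1 hgt)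
  rw [← Finset.sum_union hdisj]
  refine Finset.sum_congr (Finset.ext fun j => ?_) fun _ _ => rfl
  simp [lt_or_lt_iff_ne]

end Index

variable {d : ℕ} {n : Fin d → ℕ} {r : Fin (d + 1) → ℕ}

section Interfaces

theorem leftInterface_succ (X : Cores n r) (k : Fin d) (i : LeftIndex n k.succ) :
    leftInterface X k.succ i
      = leftInterface X k.castSucc (fun j => i ⟨j.1, j.2.trans k.castSucc_lt_succ⟩) ᵥ*
        slice (X k) (i ⟨k, k.castSucc_lt_succ⟩) := rfl

theorem rightInterface_last (X : Cores n r) :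
    rightInterface X (Fin.last d) = Matrix.of fun _ _ => 1 := by
  rw [rightInterface, Fin.reverseInduction_last]

theorem rightInterface_castSucc (X : Cores n r) (k : Fin d) (i : RightIndex n k.castSucc) :
    rightInterface X k.castSucc i = slice (X k) (i ⟨k, le_rfl⟩) *ᵥ
      rightInterface X k.succ (fun j => i ⟨j.1, k.castSucc_lt_succ.le.trans j.2⟩) := by
  rw [rightInterface, Fin.reverseInduction_castSucc]
  rfl

theorem leftInterface_congr {X Y : Cores n r} {m : Fin (d + 1)}
    (h : ∀ j : Fin d, j.castSucc < m → X j = Y j) : leftInterface X m = leftInterface Y m := by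
  induction m using Fin.induction with
  | zero => rfl
  | succ k ih =>
    funext i
    rw [leftInterface_succ, leftInterface_succ, ih fun j hj => h j (hj.trans k.castSucc_lt_succ),
      h k k.castSucc_lt_succ]

theorem rightInterface_congr {X Y : Cores n r} {m : Fin (d + 1)}
    (h : ∀ j : Fin d, m ≤ j.castSucc → X j = Y j) : rightInterface X m = rightInterface Y m := by
  induction m using Fin.reverseInduction with
  | last => rw [rightInterface_last, rightInterface_last]
  | cast k ih =>
    funext i
    rw [rightInterface_castSucc, rightInterface_castSucc,
      ih fun j hj => h j (k.castSucc_lt_succ.le.trans hj), h k le_rfl]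

theorem leftInterface_update {m : Fin (d + 1)} {j : Fin d} (h : m ≤ j.castSucc) (X : Cores n r)
    (Z : Core n r j) : leftInterface (Function.update X j Z) m = leftInterface X m :=
  leftInterface_congr fun _ hi => Function.update_of_ne
    (fun hij => (hi.trans_le h).ne (congrArg Fin.castSucc hij)) _ _

theorem rightInterface_update {m : Fin (d + 1)} {j : Fin d} (h : j.castSucc < m) (X : Cores n r)
    (Z : Core n r j) : rightInterface (Function.update X j Z) m = rightInterface X m :=
  rightInterface_congr fun _ hi => Function.update_of_ne
    (fun hij => (h.trans_le hi).ne' (congrArg Fin.castSucc hij)) _ _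

theorem phi_eq_dotProduct (X : Cores n r) (i : MultiIndex n) (m : Fin (d + 1)) :
    phi X i = leftInterface X m (fun j => i j.1) ⬝ᵥ rightInterface X m (fun j => i j.1) := by
  induction m using Fin.reverseInduction with
  | last => simp [phi, rightInterface_last, dotProduct]
  | cast k ih =>
    rw [ih, rightInterface_castSucc, leftInterface_succ, Matrix.dotProduct_mulVec]

end Interfaces

section Unfoldings

theorem glue_left (k : Fin d) (i : LeftIndex n k.castSucc) (a : Fin (n k))
    (i' : RightIndex n k.succ) (j : {j : Fin d // j.castSucc < k.castSucc}) :
    glue k i a i' j.1 = i j := by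
  simp only [glue, dif_pos j.2]

theorem glue_right (k : Fin d) (i : LeftIndex n k.castSucc) (a : Fin (n k))
    (i' : RightIndex n k.succ) (j : {j : Fin d // k.succ ≤ j.castSucc}) :
    glue k i a i' j.1 = i' j := by
  have h : ¬ j.1.castSucc < k.castSucc := (k.castSucc_lt_succ.le.trans j.2).not_gt
  simp only [glue, dif_neg h, dif_pos j.2]

theorem glue_self (k : Fin d) (i : LeftIndex n k.castSucc) (a : Fin (n k))
    (i' : RightIndex n k.succ) : glue k i a i' k = a := by
  simp only [glue, dif_neg (lt_irrefl k.castSucc), dif_neg k.castSucc_lt_succ.not_ge]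
  rfl

theorem glue_restrict (k : Fin d) (i : MultiIndex n) :
    glue k (fun j => i j.1) (i k) (fun j => i j.1) = i := by
  funext j
  rcases lt_trichotomy j k with h | rfl | h
  · exact glue_left k _ _ _ ⟨j, Fin.castSucc_lt_castSucc_iff.2 h⟩
  · exact glue_self ..
  · exact glue_right k _ _ _ ⟨j, Fin.succ_le_castSucc_iff.2 h⟩

/-- Splitting a multi-index into `i_k`, the indices before and the indices after `k`, in the order
in which `unfolding` arranges them. -/
def splitEquiv (n : Fin d → ℕ) (k : Fin d) :
    MultiIndex n ≃ (Fin (n k) × LeftIndex n k.castSucc) × RightIndex n k.succ where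
  toFun i := ((i k, fun j => i j.1), fun j => i j.1)
  invFun p := glue k p.1.2 p.1.1 p.2
  left_inv i := glue_restrict k i
  right_inv _ := Prod.ext (Prod.ext (glue_self ..) (funext fun _ => glue_left ..))
    (funext fun _ => glue_right ..)

theorem unfolding_injective (k : Fin d) :
    Function.Injective (unfolding k : (MultiIndex n → ℝ) → _) := fun _ _ h =>
  (splitEquiv n k).symm.surjective.injective_comp_right
    (funext fun p => congrFun (congrFun h p.1) p.2)

theorem dotProduct_eq_trace_unfolding (k : Fin d) (S T : MultiIndex n → ℝ) :
    S ⬝ᵥ T = ((unfolding k S)ᵀ * unfolding k T).trace := by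
  rw [dotProduct, ← (splitEquiv n k).symm.sum_comp, Fintype.sum_prod_type, Finset.sum_comm]
  rfl

theorem unfolding_phi (X : Cores n r) (k : Fin d) :
    unfolding k (phi X) = contract (leftInterface X k.castSucc) (leftUnfolding (X k))
      (rightInterface X k.succ) := by
  ext ⟨a, i⟩ i'
  rw [contract_apply, unfolding, Matrix.of_apply, phi_eq_dotProduct X _ k.succ, leftInterface_succ]
  simp only [glue_right, glue_self]
  congr 3
  exact funext (glue_left k i a i')

theorem unfolding_phi_update (X : Cores n r) (k : Fin d) (Z : Core n r k) :
    unfolding k (phi (Function.update X k Z)) = contract (leftInterface X k.castSucc)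
      (leftUnfolding Z) (rightInterface X k.succ) := by
  rw [unfolding_phi, leftInterface_update le_rfl, rightInterface_update k.castSucc_lt_succ,
    Function.update_self]

/-- `φ` as a multilinear map of the cores. -/
def phiMultilinear (n : Fin d → ℕ) (r : Fin (d + 1) → ℕ) :
    MultilinearMap ℝ (Core n r) (MultiIndex n → ℝ) where
  toFun := phi
  map_update_add' {inst} X k Y Z := by
    obtain rfl := Subsingleton.elim inst (instDecidableEqFin d)
    apply unfolding_injective k
    change _ = unfolding k (phi _) + unfolding k (phi _)
    simp only [unfolding_phi_update]
    exact contract_add ..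
  map_update_smul' {inst} X k c Z := by
    obtain rfl := Subsingleton.elim inst (instDecidableEqFin d)
    apply unfolding_injective k
    change _ = c • unfolding k (phi _)
    simp only [unfolding_phi_update]
    exact contract_smul ..

end Unfoldings

section Smoothness

theorem contDiff_leftInterface (m : Fin (d + 1)) (i : LeftIndex n m) (b : Fin (r m)) :
    ContDiff ℝ ∞ (fun X : Cores n r => leftInterface X m i b) := by
  induction m using Fin.induction with
  | zero => exact contDiff_const
  | succ k ih =>
    simp only [leftInterface_succ, Matrix.vecMul, dotProduct, slice, Matrix.of_apply]
    have hentry (a c) : ContDiff ℝ ∞ fun X : Cores n r => X k a c b :=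
      contDiff_pi.1 (contDiff_pi.1 (contDiff_pi.1 (contDiff_pi.1 contDiff_id k) a) c) b
    exact ContDiff.sum fun a _ => (ih _ a).mul (hentry a _)

theorem contDiff_phi : ContDiff ℝ ∞ (phi : Cores n r → MultiIndex n → ℝ) :=
  contDiff_pi.2 fun _ => ContDiff.sum fun _ _ => contDiff_leftInterface _ _ _

theorem fderiv_phi (X ξ : Cores n r) :
    fderiv ℝ phi X ξ = ∑ j, phi (Function.update X j (ξ j)) := by
  let f : ContinuousMultilinearMap ℝ (Core n r) (MultiIndex n → ℝ) :=
    { phiMultilinear n r with cont := contDiff_phi.continuous }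
  change fderiv ℝ f X ξ = _
  rw [(f.hasFDerivAt X).fderiv, ContinuousMultilinearMap.linearDeriv_apply]
  rfl

theorem contDiff_phi_update (k : Fin d) (Z : Core n r k) :
    ContDiff ℝ ∞ (fun X : Cores n r => phi (Function.update X k Z)) :=
  contDiff_phi.comp (contDiff_update_left k Z)

theorem fderiv_phi_update (X ξ lam : Cores n r) (k : Fin d) :
    fderiv ℝ (fun Y : Cores n r => phi (Function.update Y k (lam k))) X ξ = mixedSum X ξ lam k := by
  have hphi : DifferentiableAt ℝ phi (Function.update X k (lam k)) :=
    (contDiff_phi.differentiable (by simp)).differentiableAt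
  have hcomp := hphi.hasFDerivAt.comp X (hasFDerivAt_update_left (𝕜 := ℝ) k (lam k) X)
  change fderiv ℝ (phi ∘ fun Y => Function.update Y k (lam k)) X ξ = _
  rw [hcomp.fderiv, ContinuousLinearMap.comp_apply, fderiv_phi, mixedSum, Finset.sum_filter]
  refine Finset.sum_congr rfl fun j _ => ?_
  rcases eq_or_ne j k with rfl | hj
  · have hzero : phi (Function.update X j 0) = 0 := (phiMultilinear n r).map_update_zero X j
    simp [hzero]
  · simp [hj, Function.update_comm hj]

theorem premetric_eq_sum_dotProduct (X ξ η : Cores n r) : premetric X ξ η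
    = ∑ k, phi (Function.update X k (ξ k)) ⬝ᵥ phi (Function.update X k (η k)) := rfl

theorem contDiff_premetric (ξ η : Cores n r) : ContDiff ℝ ∞ fun X => premetric X ξ η :=
  ContDiff.sum fun k _ =>
    contDiff_dotProduct (contDiff_phi_update k (ξ k)) (contDiff_phi_update k (η k))

theorem fderiv_premetric (X u v w : Cores n r) :
    fderiv ℝ (fun Y => premetric Y v w) X u
      = ∑ k, (mixedSum X u v k ⬝ᵥ phi (Function.update X k (w k))
        + phi (Function.update X k (v k)) ⬝ᵥ mixedSum X u w k) := by
  have hphi (z : Cores n r) (k : Fin d) :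
      DifferentiableAt ℝ (fun Y => phi (Function.update Y k (z k))) X :=
    ((contDiff_phi_update k (z k)).differentiable (by simp)).differentiableAt
  have hdot (k : Fin d) : DifferentiableAt ℝ
      (fun Y => phi (Function.update Y k (v k)) ⬝ᵥ phi (Function.update Y k (w k))) X :=
    ((contDiff_dotProduct (contDiff_phi_update k (v k))
      (contDiff_phi_update k (w k))).differentiable (by simp)).differentiableAt
  simp only [premetric_eq_sum_dotProduct]
  rw [fderiv_fun_sum fun k _ => hdot k, sum_apply]
  refine Finset.sum_congr rfl fun k _ => ?_
  rw [fderiv_dotProduct (hphi v k) (hphi w k), fderiv_phi_update, fderiv_phi_update]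

end Smoothness

section FullRank

variable {X : Cores n r}

theorem rank_leftUnfolding (hX : X ∈ totalSpace n r) (k : Fin d) :
    (leftUnfolding (X k)).rank = Fintype.card (Fin (r k.succ)) := by
  rw [(hX k).1, Fintype.card_fin]

theorem rank_transpose_rightUnfolding (hX : X ∈ totalSpace n r) (k : Fin d) :
    (rightUnfolding (X k))ᵀ.rank = Fintype.card (Fin (r k.castSucc)) := by
  rw [Matrix.rank_transpose, (hX k).2, Fintype.card_fin]

theorem isOpen_totalSpace : IsOpen (totalSpace n r) := by
  have hentry (k a i b) : Continuous fun X : Cores n r => X k a i b := by fun_prop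
  have hL (k) : Continuous fun X : Cores n r => leftUnfolding (X k) :=
    continuous_matrix fun p b => hentry k p.2 p.1 b
  have hR (k) : Continuous fun X : Cores n r => (rightUnfolding (X k))ᵀ :=
    continuous_matrix fun p a => hentry k a p.2 p.1
  have heq : totalSpace n r = ⋂ k,
      (fun X => leftUnfolding (X k)) ⁻¹' {A | A.rank = Fintype.card (Fin (r k.succ))} ∩
        (fun X => (rightUnfolding (X k))ᵀ) ⁻¹'
          {A | A.rank = Fintype.card (Fin (r k.castSucc))} := by
    ext X
    simp [totalSpace, Matrix.rank_transpose]
  rw [heq]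
  exact isOpen_iInter_of_finite fun k => (isOpen_setOf_rank_eq_card_width.preimage (hL k)).inter
    (isOpen_setOf_rank_eq_card_width.preimage (hR k))

theorem rank_leftInterface (hr_zero : r 0 = 1) (hX : X ∈ totalSpace n r) (m : Fin (d + 1)) :
    (leftInterface X m).rank = Fintype.card (Fin (r m)) := by
  induction m using Fin.induction with
  | zero =>
    have : Nonempty (LeftIndex n 0) := ⟨fun j => absurd j.2 (Fin.not_lt_zero _)⟩
    exact rank_of_one_eq_card_width ((Fintype.card_fin _).trans hr_zero)
  | succ k ih =>
    refine rank_eq_card_width_iff_forall_mulVec.2 fun v hv => ?_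
    refine rank_eq_card_width_iff_forall_mulVec.1 (rank_leftUnfolding hX k) v
      (funext fun ⟨a, c⟩ => ?_)
    have hslice : slice (X k) a *ᵥ v = 0 := by
      refine rank_eq_card_width_iff_forall_mulVec.1 ih _ (funext fun i => ?_)
      obtain ⟨i', hi'k, hi'⟩ := exists_extension (β := fun j => Fin (n j))
        (p := fun j => j.castSucc < k.castSucc) (q := fun j => j.castSucc < k.succ)
        (lt_irrefl k.castSucc) k.castSucc_lt_succ (fun _ hj => hj.trans k.castSucc_lt_succ)
        (fun j hj => (Fin.castSucc_lt_succ_iff.1 hj).eq_or_lt) a i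
      have hrow : leftInterface X k.succ i' ⬝ᵥ v = 0 := congrFun hv i'
      rw [leftInterface_succ, hi'k, funext hi', ← Matrix.dotProduct_mulVec] at hrow
      exact hrow
    exact congrFun hslice c

theorem rank_rightInterface (hr_last : r (Fin.last d) = 1) (hX : X ∈ totalSpace n r)
    (m : Fin (d + 1)) : (rightInterface X m).rank = Fintype.card (Fin (r m)) := by
  induction m using Fin.reverseInduction with
  | last =>
    have : Nonempty (RightIndex n (Fin.last d)) :=
      ⟨fun j => absurd j.2 (Fin.castSucc_lt_last _).not_ge⟩
    rw [rightInterface_last]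
    exact rank_of_one_eq_card_width ((Fintype.card_fin _).trans hr_last)
  | cast k ih =>
    refine rank_eq_card_width_iff_forall_mulVec.2 fun v hv => ?_
    refine rank_eq_card_width_iff_forall_mulVec.1 (rank_transpose_rightUnfolding hX k) v
      (funext fun ⟨c, a⟩ => ?_)
    have hslice : v ᵥ* slice (X k) a = 0 := by
      refine rank_eq_card_width_iff_forall_mulVec.1 ih _ (funext fun i => ?_)
      obtain ⟨i', hi'k, hi'⟩ := exists_extension (β := fun j => Fin (n j))
        (p := fun j => k.succ ≤ j.castSucc) (q := fun j => k.castSucc ≤ j.castSucc)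
        k.castSucc_lt_succ.not_ge le_rfl (fun _ hj => k.castSucc_lt_succ.le.trans hj)
        (fun j hj => (Fin.castSucc_le_castSucc_iff.1 hj).eq_or_lt'.imp_right
          Fin.succ_le_castSucc_iff.2) a i
      have hrow : rightInterface X k.castSucc i' ⬝ᵥ v = 0 := congrFun hv i'
      rw [rightInterface_castSucc, hi'k, funext hi', dotProduct_comm,
        Matrix.dotProduct_mulVec, dotProduct_comm] at hrow
      exact hrow
    rw [Matrix.mulVec_transpose]
    exact congrFun hslice c

theorem isUnit_det_leftGram (hr_zero : r 0 = 1) (hX : X ∈ totalSpace n r) (m : Fin (d + 1)) :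
    IsUnit (leftGram X m).det :=
  isUnit_det_transpose_mul_self (rank_leftInterface hr_zero hX m)

theorem isUnit_det_rightGram (hr_last : r (Fin.last d) = 1) (hX : X ∈ totalSpace n r)
    (m : Fin (d + 1)) : IsUnit (rightGram X m).det :=
  isUnit_det_transpose_mul_self (rank_rightInterface hr_last hX m)

end FullRank

section Represent

variable {X : Cores n r} {k : Fin d}

theorem eq_zero_of_phi_update_eq_zero (hL : IsUnit (leftGram X k.castSucc).det)
    (hR : IsUnit (rightGram X k.succ).det) {Z : Core n r k}
    (hZ : phi (Function.update X k Z) = 0) : Z = 0 := by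
  have hcontract : contract (leftInterface X k.castSucc) (leftUnfolding Z)
      (rightInterface X k.succ) = 0 := by
    rw [← unfolding_phi_update, hZ]
    rfl
  have hfold : leftUnfolding Z = 0 := by
    rw [← contract_one_one (leftUnfolding Z), ← Matrix.nonsing_inv_mul _ hL,
      ← Matrix.nonsing_inv_mul _ hR, leftGram, rightGram, ← Matrix.mul_assoc, ← Matrix.mul_assoc,
      ← contract_contract, hcontract, contract, Matrix.mul_zero, Matrix.zero_mul]
  funext a i b
  exact congrFun (congrFun hfold (i, a)) b

/-- The linear form `M ↦ ⟨φ(X¹, …, M, …, X^d), φ(X¹, …, D, …, X^d)⟩` on left unfolded cores `M`,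
that is, the `k`-th summand of the preconditioned metric. -/
def coreForm (X : Cores n r) (k : Fin d) (D : Core n r k) :
    Matrix (Fin (n k) × Fin (r k.castSucc)) (Fin (r k.succ)) ℝ →ₗ[ℝ] ℝ where
  toFun M := phi (Function.update X k (leftFolding M)) ⬝ᵥ phi (Function.update X k D)
  map_add' M N := by
    rw [← add_dotProduct]
    exact congrArg (· ⬝ᵥ _) ((phiMultilinear n r).map_update_add X k _ _)
  map_smul' c M := by
    rw [RingHom.id_apply, ← smul_dotProduct]
    exact congrArg (· ⬝ᵥ _) ((phiMultilinear n r).map_update_smul X k c _)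

/-- The left unfolded `k`-th core whose `coreForm` at `X` is the linear form
`D ↦ ⟨T, φ(Z¹, …, D, …, Z^d)⟩`. All terms of `ζ` are of this kind. -/
def represent (X Z : Cores n r) (k : Fin d) (T : MultiIndex n → ℝ) :
    Matrix (Fin (n k) × Fin (r k.castSucc)) (Fin (r k.succ)) ℝ :=
  contract ((leftGram X k.castSucc)⁻¹ * (leftInterface Z k.castSucc)ᵀ) (unfolding k T)
    ((rightGram X k.succ)⁻¹ * (rightInterface Z k.succ)ᵀ)

theorem coreForm_represent (hL : IsUnit (leftGram X k.castSucc).det)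
    (hR : IsUnit (rightGram X k.succ).det) (Z : Cores n r) (T : MultiIndex n → ℝ)
    (D : Core n r k) : coreForm X k D (represent X Z k T) = T ⬝ᵥ phi (Function.update Z k D) := by
  change phi _ ⬝ᵥ phi _ = _
  simp only [dotProduct_eq_trace_unfolding k, unfolding_phi_update]
  exact trace_transpose_contract_gram_inv hL hR ..

theorem compress_eq_represent (X : Cores n r) (k : Fin d) (T : MultiIndex n → ℝ) :
    compress X k T = represent X X k T := by
  simp only [compress, represent, contract, rightGram, Matrix.transpose_mul,
    Matrix.transpose_transpose, Matrix.transpose_nonsing_inv]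

theorem represent_phi (X Y Z : Cores n r) (k : Fin d) :
    represent X Z k (phi Y) = contract
      ((leftGram X k.castSucc)⁻¹ * (leftInterface Z k.castSucc)ᵀ * leftInterface Y k.castSucc)
      (leftUnfolding (Y k))
      ((rightGram X k.succ)⁻¹ * (rightInterface Z k.succ)ᵀ * rightInterface Y k.succ) := by
  rw [represent, unfolding_phi, contract_contract]

theorem leftCorrection_eq_represent (hR : IsUnit (rightGram X k.succ).det) {Y Z : Cores n r}
    (hY : rightInterface Y k.succ = rightInterface X k.succ)
    (hZ : rightInterface Z k.succ = rightInterface X k.succ) :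
    leftCorrection X k (leftInterface Z k.castSucc) (leftInterface Y k.castSucc)
      (leftUnfolding (Y k)) = represent X Z k (phi Y) := by
  rw [represent_phi, hY, hZ, Matrix.mul_assoc (rightGram X k.succ)⁻¹, ← rightGram,
    Matrix.nonsing_inv_mul _ hR, contract, Matrix.transpose_one, Matrix.mul_one, leftCorrection]

theorem rightCorrection_eq_represent (hL : IsUnit (leftGram X k.castSucc).det) {Y Z : Cores n r}
    (hY : leftInterface Y k.castSucc = leftInterface X k.castSucc)
    (hZ : leftInterface Z k.castSucc = leftInterface X k.castSucc) :
    rightCorrection X k (leftUnfolding (Y k)) (rightInterface Y k.succ) (rightInterface Z k.succ)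
      = represent X Z k (phi Y) := by
  rw [represent_phi, hY, hZ, Matrix.mul_assoc (leftGram X k.castSucc)⁻¹, ← leftGram,
    Matrix.nonsing_inv_mul _ hL, contract, Matrix.one_kronecker_one, Matrix.one_mul,
    rightCorrection]
  simp only [rightGram, Matrix.transpose_mul, Matrix.transpose_transpose,
    Matrix.transpose_nonsing_inv, Matrix.mul_assoc]

end Represent

section Connection

variable {X : Cores n r} {k : Fin d}

theorem sum_leftCorrection_add_sum_rightCorrection
    (hL : IsUnit (leftGram X k.castSucc).det) (hR : IsUnit (rightGram X k.succ).det)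
    (ξ : Cores n r) {Y : Fin d → Cores n r}
    (hYr : ∀ j < k, rightInterface (Y j) k.succ = rightInterface X k.succ)
    (hYl : ∀ j > k, leftInterface (Y j) k.castSucc = leftInterface X k.castSucc) :
    ∑ j ∈ Finset.Iio k, leftCorrection X k (modLeft X ξ k.castSucc j)
        (leftInterface (Y j) k.castSucc) (leftUnfolding (Y j k))
      + ∑ j ∈ Finset.Ioi k, rightCorrection X k (leftUnfolding (Y j k))
        (rightInterface (Y j) k.succ) (modRight X ξ k.succ j)
      = ∑ j with j ≠ k, represent X (Function.update X j (ξ j)) k (phi (Y j)) := by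
  rw [← sum_Iio_add_sum_Ioi]
  refine congrArg₂ (· + ·) (Finset.sum_congr rfl fun j hj => ?_)
    (Finset.sum_congr rfl fun j hj => ?_)
  · have hjk := Finset.mem_Iio.1 hj
    exact leftCorrection_eq_represent hR (hYr j hjk) (rightInterface_update
      ((Fin.castSucc_lt_castSucc_iff.2 hjk).trans k.castSucc_lt_succ) _ _)
  · have hjk := Finset.mem_Ioi.1 hj
    exact rightCorrection_eq_represent hL (hYl j hjk) (leftInterface_update
      (Fin.castSucc_le_castSucc_iff.2 hjk.le) _ _)

theorem sum_correction_core (hL : IsUnit (leftGram X k.castSucc).det)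
    (hR : IsUnit (rightGram X k.succ).det) (ξ lam : Cores n r) :
    ∑ j ∈ Finset.Iio k, leftCorrection X k (modLeft X ξ k.castSucc j)
        (leftInterface X k.castSucc) (leftUnfolding (lam k))
      + ∑ j ∈ Finset.Ioi k, rightCorrection X k (leftUnfolding (lam k))
        (rightInterface X k.succ) (modRight X ξ k.succ j)
      = ∑ j with j ≠ k,
        represent X (Function.update X j (ξ j)) k (phi (Function.update X k (lam k))) := by
  have hl := leftInterface_update le_rfl X (lam k)
  have hr := rightInterface_update k.castSucc_lt_succ X (lam k)
  simpa only [hl, hr, Function.update_self] using sum_leftCorrection_add_sum_rightCorrection hL hR ξ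
    (Y := fun _ => Function.update X k (lam k)) (fun _ _ => hr) (fun _ _ => hl)

theorem sum_correction_modified (hL : IsUnit (leftGram X k.castSucc).det)
    (hR : IsUnit (rightGram X k.succ).det) (ξ lam : Cores n r) :
    ∑ j ∈ Finset.Iio k, leftCorrection X k (modLeft X ξ k.castSucc j)
        (modLeft X lam k.castSucc j) (leftUnfolding (X k))
      + ∑ j ∈ Finset.Ioi k, rightCorrection X k (leftUnfolding (X k))
        (modRight X lam k.succ j) (modRight X ξ k.succ j)
      = ∑ j with j ≠ k,
        represent X (Function.update X j (ξ j)) k (phi (Function.update X j (lam j))) := by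
  rw [← sum_leftCorrection_add_sum_rightCorrection hL hR ξ
    (Y := fun j => Function.update X j (lam j))
    (fun j hj => rightInterface_update
      ((Fin.castSucc_lt_castSucc_iff.2 hj).trans k.castSucc_lt_succ) _ _)
    (fun j hj => leftInterface_update (Fin.castSucc_le_castSucc_iff.2 hj.le) _ _)]
  refine congrArg₂ (· + ·) (Finset.sum_congr rfl fun j hj => ?_)
    (Finset.sum_congr rfl fun j hj => ?_)
  · rw [Function.update_of_ne (Finset.mem_Iio.1 hj).ne', modLeft, modLeft]
  · rw [Function.update_of_ne (Finset.mem_Ioi.1 hj).ne, modRight, modRight]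

theorem zetaUnfolded_eq_represent (hL : IsUnit (leftGram X k.castSucc).det)
    (hR : IsUnit (rightGram X k.succ).det) (ξ lam : Cores n r) :
    zetaUnfolded X ξ lam k = represent X X k (mixedSum X ξ lam k)
      + represent X X k (mixedSum X lam ξ k)
      + ∑ j with j ≠ k,
        represent X (Function.update X j (ξ j)) k (phi (Function.update X k (lam k)))
      + ∑ j with j ≠ k,
        represent X (Function.update X j (lam j)) k (phi (Function.update X k (ξ k)))
      - ∑ j with j ≠ k,
        represent X (Function.update X j (lam j)) k (phi (Function.update X j (ξ j)))
      - ∑ j with j ≠ k,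
        represent X (Function.update X j (ξ j)) k (phi (Function.update X j (lam j))) := by
  simp only [zetaUnfolded, compress_eq_represent, ← sum_correction_core hL hR,
    ← sum_correction_modified hL hR]
  abel

theorem coreForm_zetaUnfolded (hL : IsUnit (leftGram X k.castSucc).det)
    (hR : IsUnit (rightGram X k.succ).det) (ξ lam η : Cores n r) :
    coreForm X k (η k) (zetaUnfolded X ξ lam k)
      = mixedSum X ξ lam k ⬝ᵥ phi (Function.update X k (η k))
      + mixedSum X lam ξ k ⬝ᵥ phi (Function.update X k (η k))
      + phi (Function.update X k (lam k)) ⬝ᵥ mixedSum X ξ η k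
      + phi (Function.update X k (ξ k)) ⬝ᵥ mixedSum X lam η k
      - ∑ j with j ≠ k, phi (Function.update X j (ξ j)) ⬝ᵥ
          phi (Function.update (Function.update X j (lam j)) k (η k))
      - ∑ j with j ≠ k, phi (Function.update X j (lam j)) ⬝ᵥ
          phi (Function.update (Function.update X j (ξ j)) k (η k)) := by
  simp only [zetaUnfolded_eq_represent hL hR, map_add, map_sub, map_sum,
    coreForm_represent hL hR, ← dotProduct_sum]
  rfl

theorem sum_sum_phi_dotProduct_swap (X ξ lam η : Cores n r) :
    ∑ k, ∑ j with j ≠ k, phi (Function.update X j (ξ j)) ⬝ᵥ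
        phi (Function.update (Function.update X j (lam j)) k (η k))
      = ∑ k, phi (Function.update X k (ξ k)) ⬝ᵥ mixedSum X η lam k := by
  simp only [mixedSum, dotProduct_sum, Finset.sum_filter]
  rw [Finset.sum_comm]
  refine Finset.sum_congr rfl fun j _ => Finset.sum_congr rfl fun k _ => ?_
  rcases eq_or_ne j k with rfl | hjk
  · simp
  · rw [if_pos hjk, if_pos hjk.symm, Function.update_comm hjk]

theorem premetric_zeta (hL : ∀ m, IsUnit (leftGram X m).det) (hR : ∀ m, IsUnit (rightGram X m).det)
    (ξ lam η : Cores n r) :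
    premetric X (zeta X ξ lam) η = FlatRiemannian.koszul premetric X ξ lam η := by
  have hsum : premetric X (zeta X ξ lam) η
      = ∑ k, coreForm X k (η k) (zetaUnfolded X ξ lam k) := rfl
  simp only [hsum, coreForm_zetaUnfolded (hL _) (hR _), FlatRiemannian.koszul, fderiv_premetric,
    Finset.sum_add_distrib, Finset.sum_sub_distrib, sum_sum_phi_dotProduct_swap,
    dotProduct_comm (mixedSum X η ξ _)]
  ring

end Connection

section Metric

theorem isRiemannianMetricOn_premetric (hr_zero : r 0 = 1) (hr_last : r (Fin.last d) = 1) :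
    FlatRiemannian.IsRiemannianMetricOn (totalSpace n r) premetric where
  add_left X _ v v' w := by
    have hadd (k) : phi (Function.update X k (v k + v' k)) = _ :=
      (phiMultilinear n r).map_update_add X k (v k) (v' k)
    simp only [premetric_eq_sum_dotProduct, Pi.add_apply, hadd, add_dotProduct,
      Finset.sum_add_distrib]
    rfl
  smul_left X _ c v w := by
    have hsmul (k) : phi (Function.update X k (c • v k)) = _ :=
      (phiMultilinear n r).map_update_smul X k c (v k)
    simp only [premetric_eq_sum_dotProduct, Pi.smul_apply, hsmul, smul_dotProduct, smul_eq_mul,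
      Finset.mul_sum]
    rfl
  symm X _ v w := by simp only [premetric_eq_sum_dotProduct, dotProduct_comm]
  pos X hX v hv := by
    have hnonneg (u : MultiIndex n → ℝ) : 0 ≤ u ⬝ᵥ u :=
      Finset.sum_nonneg fun _ _ => mul_self_nonneg _
    obtain ⟨k, hk⟩ := Function.ne_iff.1 hv
    rw [premetric_eq_sum_dotProduct]
    refine Finset.sum_pos' (fun j _ => hnonneg _) ⟨k, Finset.mem_univ k, ?_⟩
    refine (hnonneg _).lt_of_ne' fun h => hk ?_
    exact eq_zero_of_phi_update_eq_zero (isUnit_det_leftGram hr_zero hX _)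
      (isUnit_det_rightGram hr_last hX _) (dotProduct_self_eq_zero.1 h)
  smooth v w := (contDiff_premetric v w).contDiffOn

end Metric

end TensorTrain

end

theorem mainTheorem7 (d : ℕ) (n : Fin d → ℕ) (r : Fin (d + 1) → ℕ)
    (hr_zero : r 0 = 1) (hr_last : r (Fin.last d) = 1) :
    -- the total space is open, and the preconditioned metric is a Riemannian metric on it
    IsOpen (TensorTrain.totalSpace n r) ∧
    FlatRiemannian.IsRiemannianMetricOn (TensorTrain.totalSpace n r) TensorTrain.premetric ∧
    -- its Levi-Civita connection exists and is given by the closed formula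
    (∃ cov : (TensorTrain.Cores n r → TensorTrain.Cores n r) → TensorTrain.Cores n r →
        (TensorTrain.Cores n r →L[ℝ] TensorTrain.Cores n r),
      FlatRiemannian.IsLeviCivitaOn (TensorTrain.totalSpace n r) TensorTrain.premetric cov) ∧
    ∀ cov : (TensorTrain.Cores n r → TensorTrain.Cores n r) → TensorTrain.Cores n r →
        (TensorTrain.Cores n r →L[ℝ] TensorTrain.Cores n r),
      FlatRiemannian.IsLeviCivitaOn (TensorTrain.totalSpace n r) TensorTrain.premetric cov →
      ∀ (lam : TensorTrain.Cores n r → TensorTrain.Cores n r),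
      ∀ X ∈ TensorTrain.totalSpace n r, DifferentiableAt ℝ lam X →
      ∀ ξ : TensorTrain.Cores n r,
        cov lam X ξ = fderiv ℝ lam X ξ + (1 / 2 : ℝ) • TensorTrain.zeta X ξ (lam X) := by
  have hg := TensorTrain.isRiemannianMetricOn_premetric (n := n) hr_zero hr_last
  have hopen := TensorTrain.isOpen_totalSpace (n := n) (r := r)
  refine ⟨hopen, hg, hg.exists_isLeviCivitaOn hopen, fun cov hcov lam X hX hlam ξ =>
    hcov.eq_fderiv_add hg hopen hX hlam fun η => ?_⟩
  rw [hg.smul_left X hX, TensorTrain.premetric_zeta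
    (TensorTrain.isUnit_det_leftGram hr_zero hX) (TensorTrain.isUnit_det_rightGram hr_last hX)]
  ring
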